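/- Let $\mathcal H$ and $\mathcal G$ be real Hilbert spaces. For a real Hilbert space $\mathcal X$, set $\mathscr Q_{\mathcal X}=\|\cdot\|_{\mathcal X}^2/2$ and, for $f\colon\mathcal X\to[-\infty,+\infty]$ and $\gamma\in\,]0,+\infty[$, let $$f^*(u)=\sup_{x\in\mathcal X}\big(\langle x,u\rangle_{\mathcal X}-f(x)\big),\qquad {}^{\gamma}\!f(x)=\inf_{y\in\mathcal X}\Big(f(y)+\tfrac1\gamma\mathscr Q_{\mathcal X}(x-y)\Big),\qquad \operatorname{Argmin} f=\{x\in\mathcal X : f(x)=\inf f(\mathcal X)\}$$ denote the Legendre conjugate, the Moreau envelope of index $\gamma$, and the set of global minimizers of $f$. For a bounded linear operator $L\colon\mathcal H\to\mathcal G$, a function $g\colon\mathcal G\to[-\infty,+\infty]$, and $\gamma\in\,]0,+\infty[$, the proximal composition and the proximal cocomposition of $g$ and $L$ with parameter $\gamma$ are the functions from $\mathcal H$ to $[-\infty,+\infty]$ $$L\diamond^{\gamma} g=\big({}^{1/\gamma}(g^*)\circ L\big)^*-\tfrac1\gamma\mathscr Q_{\mathcal H},\qquad L\triangleright^{\gamma}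 g=\big(L\diamond^{1/\gamma} g^*\big)^*.$$ Suppose that $0<\|L\|\le 1$ and that $g\colon\mathcal G\to\,]-\infty,+\infty]$ is proper (i.e., not identically $+\infty$) and has a continuous affine minorant. Let $\gamma,\rho\in\,]0,+\infty[$. Then: 1. ${}^{\rho}\big(L\triangleright^{\gamma+\rho} g\big)=L\triangleright^{\gamma}\big({}^{\rho}g\big)$; 2. ${}^{\gamma}\big(L\triangleright^{\gamma} g\big)={}^{\gamma}(g^{**})\circ L$; 3. $\operatorname{Argmin}\big(L\triangleright^{\gamma} g\big)=\operatorname{Argmin}\big({}^{\gamma}(g^{**})\circ L\big)$. -/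

import Mathlib

noncomputable section

namespace ProxComp

variable {H : Type*} [NormedAddCommGroup H] [InnerProductSpace ℝ H]
variable {G : Type*} [NormedAddCommGroup G] [InnerProductSpace ℝ G]

/-- The quadratic kernel `Q(x) = ‖x‖² / 2`. -/
def quadKernel (x : H) : ℝ := ‖x‖ ^ 2 / 2

/-- The Legendre conjugate of an extended-real-valued function on a real Hilbert space. -/
def conj (f : H → EReal) : H → EReal :=
  fun u => ⨆ x : H, (((inner ℝ x u : ℝ) : EReal) - f x)

/-- The Moreau envelope of index `γ` (meaningful for `0 < γ`). -/
def moreau (γ : ℝ) (f : H → EReal) : H → EReal :=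
  fun x => ⨅ y : H, (f y + ((1 / γ * quadKernel (x - y) : ℝ) : EReal))

/-- The proximal composition of `g` and `L` with parameter `γ`:
the conjugate of (the Moreau envelope of index `1/γ` of the conjugate of `g`) `∘ L`,
minus the quadratic kernel of `H` divided by `γ`. -/
def proxComp (L : H →L[ℝ] G) (γ : ℝ) (g : G → EReal) : H → EReal :=
  fun x => conj (moreau (1 / γ) (conj g) ∘ L) x - ((1 / γ * quadKernel x : ℝ) : EReal)

/-- The proximal cocomposition of `g` and `L` with parameter `γ`. -/
def proxCocomp (L : H →L[ℝ] G) (γ : ℝ) (g : G → EReal) : H → EReal :=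
  conj (proxComp L (1 / γ) (conj g))

/-- A function is proper if it is not identically `+∞` and never takes the value `-∞`. -/
def IsProper (f : H → EReal) : Prop := (∃ x, f x < ⊤) ∧ ∀ x, f x ≠ ⊥

/-- The set of continuous affine minorants of `f`. -/
def cam (f : H → EReal) : Set (H →ᴬ[ℝ] ℝ) := {h | ∀ x, ((h x : ℝ) : EReal) ≤ f x}

/-- The set of global minimizers of `f`. -/
def argmin (f : H → EReal) : Set H := {x | ∀ y, f x ≤ f y}

end ProxComp

end

set_option linter.unusedSectionVars false

namespace ProxComp

variable {H : Type*} [NormedAddCommGroup H] [InnerProductSpace ℝ H]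
variable {G : Type*} [NormedAddCommGroup G] [InnerProductSpace ℝ G]

/-! ### The quadratic kernel -/

/-! The cocomposition is `invMoreau γ` applied to `moreau γ (g**) ∘ L` (`proxCocomp_eq`), so claim 2
says that this composite is itself a Moreau envelope of index `γ`. By `moreau_invMoreau`, a
real-valued function equal to its biconjugate is such an envelope if at every point, up to any `ε`,
a paraboloid of curvature `1/γ` touches it from above; nonexpansive `L` preserves this property
(`moreau_invMoreau_comp`). Claim 1 follows from claim 2 by the semigroup law `moreau_moreau` and by
cancelling an envelope with `invMoreau_moreau`. Claim 3 follows from claim 2 because a conjugate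
with real-valued envelope has the same minimizers as that envelope (`argmin_moreau`). -/

lemma quadKernel_nonneg (x : H) : 0 ≤ quadKernel x := by
  unfold quadKernel; positivity

lemma quadKernel_add (x y : H) :
    quadKernel (x + y) = quadKernel x + inner ℝ x y + quadKernel y := by
  unfold quadKernel; rw [norm_add_sq_real]; ring

lemma quadKernel_sub (x y : H) :
    quadKernel (x - y) = quadKernel x - inner ℝ x y + quadKernel y := by
  unfold quadKernel; rw [norm_sub_sq_real]; ring

lemma quadKernel_smul (t : ℝ) (x : H) : quadKernel (t • x) = t ^ 2 * quadKernel x := by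
  unfold quadKernel; rw [norm_smul, mul_pow, Real.norm_eq_abs, sq_abs]; ring

lemma inner_self_eq_quadKernel (x : H) : inner ℝ x x = 2 * quadKernel x := by
  unfold quadKernel; rw [real_inner_self_eq_norm_sq]; ring

lemma inner_le_quadKernel {t : ℝ} (ht : 0 < t) (x u : H) :
    inner ℝ x u ≤ 1 / t * quadKernel x + t * quadKernel u := by
  have h := quadKernel_nonneg (x - t • u)
  rw [quadKernel_sub, quadKernel_smul, inner_smul_right] at h
  have h2 : 1 / t * quadKernel x + t * quadKernel u - inner ℝ x u
      = 1 / t * (quadKernel x - t * inner ℝ x u + t ^ 2 * quadKernel u) := by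
    field_simp
    ring
  have := mul_nonneg (one_div_pos.2 ht).le h
  linarith

lemma quadKernel_combo_le {a b : ℝ} (ha : 0 ≤ a) (hb : 0 ≤ b) (hab : a + b = 1) (x y : H) :
    quadKernel (a • x + b • y) ≤ a * quadKernel x + b * quadKernel y := by
  have h := mul_nonneg (mul_nonneg ha hb) (quadKernel_nonneg (x - y))
  rw [quadKernel_sub] at h
  rw [quadKernel_add, quadKernel_smul, quadKernel_smul, inner_smul_left, inner_smul_right]
  simp only [conj_trivial]
  obtain rfl : b = 1 - a := by linarith
  linarith

/-- Convexity at `x/s` and `y/t` with weights `s/(s+t)` and `t/(s+t)`, rescaled by `s+t`. -/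
lemma quadKernel_add_le {s t : ℝ} (hs : 0 < s) (ht : 0 < t) (x y : H) :
    1 / (s + t) * quadKernel (x + y) ≤ 1 / s * quadKernel x + 1 / t * quadKernel y := by
  have h := quadKernel_combo_le (a := s / (s + t)) (b := t / (s + t)) (by positivity)
    (by positivity) (by field_simp) (s⁻¹ • x) (t⁻¹ • y)
  have e : (s / (s + t)) • s⁻¹ • x + (t / (s + t)) • t⁻¹ • y = (1 / (s + t)) • (x + y) := by
    rw [smul_smul, smul_smul, smul_add]
    congr 2 <;> field_simp
  rw [e, quadKernel_smul, quadKernel_smul, quadKernel_smul] at h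
  have h' := mul_le_mul_of_nonneg_left h (add_pos hs ht).le
  have e1 : (s + t) * ((1 / (s + t)) ^ 2 * quadKernel (x + y))
      = 1 / (s + t) * quadKernel (x + y) := by field_simp
  have e2 : (s + t) * (s / (s + t) * (s⁻¹ ^ 2 * quadKernel x)
      + t / (s + t) * (t⁻¹ ^ 2 * quadKernel y))
      = 1 / s * quadKernel x + 1 / t * quadKernel y := by field_simp
  rwa [e1, e2] at h'

lemma quadKernel_map_le {L : H →L[ℝ] G} (hL : ‖L‖ ≤ 1) (x : H) :
    quadKernel (L x) ≤ quadKernel x := by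
  have : ‖L x‖ ≤ ‖x‖ := by simpa using L.le_of_opNorm_le hL x
  unfold quadKernel
  gcongr

lemma continuous_quadKernel : Continuous (quadKernel : H → ℝ) := by
  unfold quadKernel; fun_prop

/-! ### Real characterizations of conjugates and envelopes -/

lemma eq_of_forall_le_coe_iff {a b : EReal} (h : ∀ r : ℝ, a ≤ r ↔ b ≤ r) : a = b :=
  le_antisymm (EReal.le_of_forall_lt_iff_le.1 fun r hr => (h r).2 hr.le)
    (EReal.le_of_forall_lt_iff_le.1 fun r hr => (h r).1 hr.le)

/-- Testing against real bounds of `f` keeps all later arithmetic in `ℝ`. -/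
lemma conj_le_coe_iff {f : H → EReal} {u : H} {a : ℝ} :
    conj f u ≤ a ↔ ∀ (x : H) (r : ℝ), f x ≤ r → inner ℝ x u ≤ a + r := by
  unfold conj
  rw [iSup_le_iff]
  refine forall_congr' fun x => ?_
  induction f x with
  | bot =>
    simp only [EReal.coe_sub_bot, top_le_iff, EReal.coe_ne_top, bot_le, forall_const, false_iff,
      not_forall, not_le]
    exact ⟨inner ℝ x u - a - 1, by linarith⟩
  | top => simp
  | coe s =>
    norm_cast
    constructor
    · intro h r hr; linarith
    · intro h; linarith [h s le_rfl]

lemma moreau_lt_coe_iff {γ : ℝ} {f : H → EReal} {x : H} {a : ℝ} :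
    moreau γ f x < a ↔ ∃ (y : H) (r : ℝ), f y ≤ r ∧ r + 1 / γ * quadKernel (x - y) < a := by
  unfold moreau
  rw [iInf_lt_iff]
  refine exists_congr fun y => ?_
  induction f y with
  | bot =>
    simp only [EReal.bot_add, EReal.bot_lt_coe, bot_le, true_and, true_iff]
    exact ⟨a - 1 / γ * quadKernel (x - y) - 1, by linarith⟩
  | top => rw [EReal.top_add_coe]; simp
  | coe s =>
    norm_cast
    constructor
    · intro h; exact ⟨s, le_rfl, h⟩
    · rintro ⟨r, hr, h⟩; linarith

lemma coe_le_moreau_iff {γ : ℝ} {f : H → EReal} {x : H} {a : ℝ} :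
    (a : EReal) ≤ moreau γ f x ↔
      ∀ (y : H) (r : ℝ), f y ≤ r → a ≤ r + 1 / γ * quadKernel (x - y) := by
  rw [← not_lt, moreau_lt_coe_iff]
  push Not
  rfl

lemma moreau_le_of_le {γ : ℝ} {f : H → EReal} {y : H} {r : ℝ} (h : f y ≤ r) (x : H) :
    moreau γ f x ≤ ((r + 1 / γ * quadKernel (x - y) : ℝ) : EReal) := by
  refine (iInf_le _ y).trans ?_
  rw [EReal.coe_add]
  gcongr

lemma moreau_le (γ : ℝ) (f : H → EReal) (x : H) : moreau γ f x ≤ f x := by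
  refine (iInf_le _ x).trans ?_
  simp [quadKernel]

/-! ### Calculus of conjugates and envelopes -/

lemma conj_conj_le (f : H → EReal) (x : H) : conj (conj f) x ≤ f x := by
  refine EReal.le_of_forall_lt_iff_le.1 fun r hr => ?_
  rw [conj_le_coe_iff]
  intro u s hs
  have := conj_le_coe_iff.1 hs x r hr.le
  rw [real_inner_comm]
  linarith

lemma conj_conj_conj (f : H → EReal) : conj (conj (conj f)) = conj f := by
  funext u
  refine le_antisymm (conj_conj_le _ u) ?_
  exact iSup_mono fun x => EReal.sub_le_sub le_rfl (conj_conj_le f x)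

lemma conj_moreau {γ : ℝ} (hγ : 0 < γ) (f : H → EReal) (u : H) :
    conj (moreau γ f) u = conj f u + ((γ * quadKernel u : ℝ) : EReal) := by
  refine eq_of_forall_le_coe_iff fun a => ?_
  have e : conj f u + ((γ * quadKernel u : ℝ) : EReal) ≤ a
      ↔ conj f u ≤ ((a - γ * quadKernel u : ℝ) : EReal) := by
    rw [EReal.coe_sub, EReal.le_sub_iff_add_le (by simp) (by simp)]
  rw [e, conj_le_coe_iff, conj_le_coe_iff]
  constructor
  · intro h y r hr
    -- `y + γ • u` maximizes `⟨·, u⟩ - Q(· - y)/γ`.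
    have h1 := h (y + γ • u) _ (moreau_le_of_le hr _)
    rw [add_sub_cancel_left, quadKernel_smul, inner_add_left, inner_smul_left,
      inner_self_eq_quadKernel] at h1
    have e2 : 1 / γ * (γ ^ 2 * quadKernel u) = γ * quadKernel u := by field_simp
    rw [e2] at h1
    simp only [conj_trivial] at h1
    linarith
  · intro h x r hr
    refine le_of_forall_pos_le_add fun ε hε => ?_
    have h1 : moreau γ f x < ((r + ε : ℝ) : EReal) :=
      hr.trans_lt (EReal.coe_lt_coe_iff.2 (by linarith))
    obtain ⟨y, s, hs, hy⟩ := moreau_lt_coe_iff.1 h1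
    have h2 := h y s hs
    have h3 := inner_le_quadKernel hγ (x - y) u
    rw [inner_sub_left] at h3
    linarith

lemma moreau_moreau {γ ρ : ℝ} (hγ : 0 < γ) (hρ : 0 < ρ) (f : H → EReal) :
    moreau γ (moreau ρ f) = moreau (γ + ρ) f := by
  funext x
  apply le_antisymm
  · refine EReal.le_of_forall_lt_iff_le.1 fun a ha => ?_
    obtain ⟨z, r, hr, h⟩ := moreau_lt_coe_iff.1 ha
    -- This point of the segment gives equality in `quadKernel_add_le`.
    have h1 := moreau_le_of_le (moreau_le_of_le (γ := ρ) hr (z + (ρ / (γ + ρ)) • (x - z)))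
      (γ := γ) x
    refine h1.trans (EReal.coe_le_coe_iff.2 (le_trans (le_of_eq ?_) h.le))
    have e1 : x - (z + (ρ / (γ + ρ)) • (x - z)) = (γ / (γ + ρ)) • (x - z) := by
      have : γ / (γ + ρ) = 1 - ρ / (γ + ρ) := by field_simp; ring
      rw [this]; module
    rw [e1, add_sub_cancel_left, quadKernel_smul, quadKernel_smul]
    field_simp
    ring
  · refine EReal.le_of_forall_lt_iff_le.1 fun a ha => ?_
    obtain ⟨y, r, hr, h⟩ := moreau_lt_coe_iff.1 ha
    have h1 : moreau ρ f y < ((a - 1 / γ * quadKernel (x - y) : ℝ) : EReal) :=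
      hr.trans_lt (EReal.coe_lt_coe_iff.2 (by linarith))
    obtain ⟨z, s, hs, h2⟩ := moreau_lt_coe_iff.1 h1
    refine (moreau_le_of_le hs x).trans (EReal.coe_le_coe_iff.2 ?_)
    have h3 := quadKernel_add_le hγ hρ (x - y) (y - z)
    rw [sub_add_sub_cancel] at h3
    linarith

lemma conj_combo_le {φ : H → EReal} {a b : ℝ} (ha : 0 ≤ a) (hb : 0 ≤ b) (hab : a + b = 1)
    {x y : H} {r s : ℝ} (hx : conj φ x ≤ r) (hy : conj φ y ≤ s) :
    conj φ (a • x + b • y) ≤ ((a * r + b * s : ℝ) : EReal) := by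
  rw [conj_le_coe_iff] at *
  intro z t ht
  have h1 := mul_le_mul_of_nonneg_left (hx z t ht) ha
  have h2 := mul_le_mul_of_nonneg_left (hy z t ht) hb
  rw [inner_add_right, inner_smul_right, inner_smul_right]
  obtain rfl : b = 1 - a := by linarith
  linarith

/-- A conjugate that is not identically `-∞` has a continuous affine minorant. -/
lemma exists_inner_le_of_conj_ne_bot {φ : H → EReal} {x₀ : H} (h : conj φ x₀ ≠ ⊥) :
    ∃ (u : H) (c : ℝ), ∀ (x : H) (r : ℝ), conj φ x ≤ r → inner ℝ x u ≤ r + c := by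
  by_contra! hne
  apply h
  refine EReal.eq_bot_iff_forall_lt _ |>.2 fun a => ?_
  have : conj φ x₀ ≤ ((a - 1 : ℝ) : EReal) := by
    rw [conj_le_coe_iff]
    intro u c hc
    obtain ⟨x, r, hx, hlt⟩ := hne u c
    have := conj_le_coe_iff.1 hx u c hc
    rw [real_inner_comm] at hlt
    linarith
  exact this.trans_lt (EReal.coe_lt_coe_iff.2 (by linarith))

lemma exists_coe_eq_moreau {γ : ℝ} (hγ : 0 < γ) {φ : H → EReal} (hp : IsProper (conj φ)) :
    ∃ f : H → ℝ, moreau γ (conj φ) = fun x => (f x : EReal) := by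
  obtain ⟨⟨y, hy⟩, hbot⟩ := hp
  obtain ⟨r, hr⟩ : ∃ r : ℝ, conj φ y = r := ⟨_, (EReal.coe_toReal hy.ne (hbot y)).symm⟩
  obtain ⟨u, c, hu⟩ := exists_inner_le_of_conj_ne_bot (hbot y)
  refine ⟨fun x => (moreau γ (conj φ) x).toReal, funext fun x => (EReal.coe_toReal ?_ ?_).symm⟩
  · exact ((moreau_le_of_le hr.le x).trans_lt (EReal.coe_lt_top _)).ne
  · have : ((inner ℝ x u - c - γ * quadKernel u : ℝ) : EReal) ≤ moreau γ (conj φ) x := by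
      rw [coe_le_moreau_iff]
      intro z s hs
      have h1 := hu z s hs
      have h2 := inner_le_quadKernel hγ (x - z) u
      rw [inner_sub_left] at h2
      linarith
    exact ((EReal.bot_lt_coe _).trans_le this).ne'

lemma convexOn_moreau {γ : ℝ} (hγ : 0 < γ) {φ : H → EReal} {f : H → ℝ}
    (hf : moreau γ (conj φ) = fun x => (f x : EReal)) : ConvexOn ℝ Set.univ f := by
  refine ⟨convex_univ, fun x _ y _ a b ha hb hab => ?_⟩
  simp only [smul_eq_mul]
  refine le_of_forall_pos_le_add fun ε hε => ?_
  have key : ∀ x, ∃ (z : H) (r : ℝ), conj φ z ≤ r ∧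
      r + 1 / γ * quadKernel (x - z) < f x + ε := fun x => by
    rw [← moreau_lt_coe_iff, hf]
    exact EReal.coe_lt_coe_iff.2 (by linarith)
  obtain ⟨z, r, hr, hz⟩ := key x
  obtain ⟨w, s, hs, hw⟩ := key y
  have h1 := moreau_le_of_le (γ := γ) (conj_combo_le ha hb hab hr hs) (a • x + b • y)
  rw [hf] at h1
  replace h1 := EReal.coe_le_coe_iff.1 h1
  have e : a • x + b • y - (a • z + b • w) = a • (x - z) + b • (y - w) := by module
  rw [e] at h1
  have h2 := mul_le_mul_of_nonneg_left (quadKernel_combo_le ha hb hab (x - z) (y - w))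
    (one_div_pos.2 hγ).le
  have h3 := mul_le_mul_of_nonneg_left hz.le ha
  have h4 := mul_le_mul_of_nonneg_left hw.le hb
  obtain rfl : b = 1 - a := by linarith
  linarith

lemma continuous_moreau {γ : ℝ} (hγ : 0 < γ) {φ : H → EReal} {f : H → ℝ}
    (hf : moreau γ (conj φ) = fun x => (f x : EReal)) : Continuous f := by
  rw [← continuousOn_univ]
  -- A finite convex function bounded above near one point is continuous; the bound is a single
  -- paraboloid.
  refine ((convexOn_moreau hγ hf).continuousOn_tfae isOpen_univ Set.univ_nonempty).out 3 1 |>.1 ?_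
  have h0 : moreau γ (conj φ) 0 < ((f 0 + 1 : ℝ) : EReal) := by
    rw [hf]; exact EReal.coe_lt_coe_iff.2 (by linarith)
  obtain ⟨z, r, hr, -⟩ := moreau_lt_coe_iff.1 h0
  have hle : ∀ x, f x ≤ r + 1 / γ * quadKernel (x - z) := fun x => by
    have := moreau_le_of_le (γ := γ) hr x
    rw [hf] at this
    exact EReal.coe_le_coe_iff.1 this
  have hc : Continuous fun x => r + 1 / γ * quadKernel (x - z) := by
    have := continuous_quadKernel (H := H)
    fun_prop
  exact ⟨0, trivial, hc.continuousAt.isBoundedUnder_le.mono_le (.of_forall hle)⟩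

/-- Biconjugation for continuous convex functions. -/
lemma conj_conj_coe [CompleteSpace H] {f : H → ℝ} (hf : ConvexOn ℝ Set.univ f)
    (hc : Continuous f) :
    conj (conj fun x => (f x : EReal)) = fun x => (f x : EReal) := by
  funext x
  refine le_antisymm (conj_conj_le _ x) (EReal.ge_of_forall_gt_iff_ge.1 fun a ha => ?_)
  obtain ⟨l, c, hl, hx⟩ := hf.exists_affine_le_of_lt (𝕜 := ℝ) (Set.mem_univ x)
    (EReal.coe_lt_coe_iff.1 ha) isClosed_univ (hc.lowerSemicontinuous.lowerSemicontinuousOn _)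
  set v := (InnerProductSpace.toDual ℝ H).symm l
  have hlv : ∀ y, inner ℝ v y = l y := fun y => InnerProductSpace.toDual_symm_apply
  have hle : conj (fun x => (f x : EReal)) v ≤ ((-c : ℝ) : EReal) := by
    rw [conj_le_coe_iff]
    intro y r hr
    have h1 : l y + c ≤ f y := hl ⟨y, trivial⟩
    have h2 := EReal.coe_le_coe_iff.1 hr
    rw [real_inner_comm, hlv]
    linarith
  refine le_trans ?_ (le_iSup (fun u => ((inner ℝ u x : ℝ) : EReal)
    - conj (fun x => (f x : EReal)) u) v)
  refine le_trans (le_of_eq ?_) (EReal.sub_le_sub le_rfl hle)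
  rw [← EReal.coe_sub, hlv]
  have : l x + c = a := hx
  rw [← this]
  norm_num

lemma conj_conj_moreau [CompleteSpace H] {γ : ℝ} (hγ : 0 < γ) {φ : H → EReal}
    (hp : IsProper (conj φ)) : conj (conj (moreau γ (conj φ))) = moreau γ (conj φ) := by
  obtain ⟨f, hf⟩ := exists_coe_eq_moreau hγ hp
  have := conj_conj_coe (convexOn_moreau hγ hf) (continuous_moreau hγ hf)
  rwa [← hf] at this

/-- Both envelopes have conjugate `g* + γQ`, since `g*** = g*`, and the right-hand one equals its
biconjugate. -/
lemma conj_conj_moreau_eq [CompleteSpace H] {γ : ℝ} (hγ : 0 < γ) {g : H → EReal}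
    (hp : IsProper (conj (conj g))) :
    conj (conj (moreau γ g)) = moreau γ (conj (conj g)) := by
  rw [← conj_conj_moreau hγ hp]
  congr 1
  funext u
  rw [conj_moreau hγ, conj_moreau hγ, conj_conj_conj]

/-! ### Inverting the Moreau envelope -/

/-- The conjugate of `f^* - γ Q`, a left inverse of the Moreau envelope of index `γ`. -/
noncomputable def invMoreau (γ : ℝ) (f : H → EReal) : H → EReal :=
  conj fun u => conj f u - ((γ * quadKernel u : ℝ) : EReal)

lemma invMoreau_moreau {γ : ℝ} (hγ : 0 < γ) {p : H → EReal} (hp : conj (conj p) = p) :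
    invMoreau γ (moreau γ p) = p := by
  conv_rhs => rw [← hp]
  unfold invMoreau
  congr 1
  funext u
  rw [conj_moreau hγ, EReal.add_sub_cancel_right]

/-- Conjugation turns the bound on `f* - γQ` into majorization of `f` by a paraboloid centred at
`x`; thus `invMoreau γ f x` is the supremum of `f w - Q(w - x)/γ`. -/
lemma invMoreau_le_coe_iff {γ : ℝ} (hγ : 0 < γ) {f : H → ℝ}
    (hf : conj (conj fun x => (f x : EReal)) = fun x => (f x : EReal)) {x : H} {a : ℝ} :
    invMoreau γ (fun x => (f x : EReal)) x ≤ a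
      ↔ ∀ w, f w ≤ a + 1 / γ * quadKernel (w - x) := by
  have e : ∀ (u : H) (r : ℝ), conj (fun x => (f x : EReal)) u - ((γ * quadKernel u : ℝ) : EReal) ≤ r
      ↔ conj (fun x => (f x : EReal)) u ≤ ((r + γ * quadKernel u : ℝ) : EReal) := fun u r => by
    rw [EReal.coe_add, EReal.sub_le_iff_le_add (by simp) (by simp)]
  unfold invMoreau
  rw [conj_le_coe_iff]
  simp only [e]
  constructor
  · intro h w
    have : conj (conj fun x => (f x : EReal)) w
        ≤ ((a + 1 / γ * quadKernel (w - x) : ℝ) : EReal) := by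
      rw [conj_le_coe_iff]
      intro u r hr
      have h1 := h u (r - γ * quadKernel u) (by simpa using hr)
      have h2 := inner_le_quadKernel hγ (w - x) u
      rw [inner_sub_left, real_inner_comm u w, real_inner_comm u x] at h2
      linarith
    rw [hf] at this
    exact EReal.coe_le_coe_iff.1 this
  · intro h u r hr
    -- The paraboloid centred at `x` has gradient `u` here.
    have h1 := h (x + γ • u)
    have h2 := conj_le_coe_iff.1 hr (x + γ • u) (f (x + γ • u)) le_rfl
    rw [add_sub_cancel_left, quadKernel_smul] at h1
    rw [inner_add_left, inner_smul_left, inner_self_eq_quadKernel, real_inner_comm] at h2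
    simp only [conj_trivial] at h2
    have e2 : 1 / γ * (γ ^ 2 * quadKernel u) = γ * quadKernel u := by field_simp
    rw [e2] at h1
    linarith

lemma moreau_invMoreau {γ : ℝ} (hγ : 0 < γ) {f : H → ℝ}
    (hf : conj (conj fun x => (f x : EReal)) = fun x => (f x : EReal))
    (hs : ∀ x, ∀ ε > 0, ∃ y, ∀ w,
      f w ≤ f x + ε + 1 / γ * (quadKernel (w - y) - quadKernel (x - y))) :
    moreau γ (invMoreau γ fun x => (f x : EReal)) = fun x => (f x : EReal) := by
  funext x
  apply le_antisymm
  · refine EReal.le_of_forall_lt_iff_le.1 fun a ha => ?_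
    have ha := EReal.coe_lt_coe_iff.1 ha
    obtain ⟨y, hy⟩ := hs x (a - f x) (by linarith)
    have h1 : invMoreau γ (fun x => (f x : EReal)) y
        ≤ ((a - 1 / γ * quadKernel (x - y) : ℝ) : EReal) := by
      rw [invMoreau_le_coe_iff hγ hf]
      intro w
      linarith [hy w]
    simpa using moreau_le_of_le (γ := γ) h1 x
  · rw [coe_le_moreau_iff]
    intro y r hr
    exact (invMoreau_le_coe_iff hγ hf).1 hr x

/-- The Moreau envelope of index `γ` of a conjugate, precomposed with a nonexpansive operator,
is again a Moreau envelope of index `γ`. -/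
lemma moreau_invMoreau_comp [CompleteSpace H] [CompleteSpace G] {L : H →L[ℝ] G} (hL : ‖L‖ ≤ 1)
    {γ : ℝ} (hγ : 0 < γ) {φ : G → EReal} {e : G → ℝ}
    (he : moreau γ (conj φ) = fun x => (e x : EReal)) :
    moreau γ (invMoreau γ fun x => (e (L x) : EReal)) = fun x => (e (L x) : EReal) := by
  refine moreau_invMoreau hγ (f := fun x => e (L x)) (conj_conj_coe (f := fun x => e (L x)) ?_ ?_)
    fun x ε hε => ?_
  · exact (convexOn_moreau hγ he).comp_linearMap L.toLinearMap
  · exact (continuous_moreau hγ he).comp L.continuous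
  · have h0 : moreau γ (conj φ) (L x) < ((e (L x) + ε : ℝ) : EReal) := by
      rw [he]; exact EReal.coe_lt_coe_iff.2 (by linarith)
    obtain ⟨z, r, hr, hz⟩ := moreau_lt_coe_iff.1 h0
    -- With this centre the terms linear in `w - x` agree on both sides, leaving only `Q(L(w - x)) ≤
    -- Q(w - x)`.
    refine ⟨x - L.adjoint (L x - z), fun w => ?_⟩
    have h1 := moreau_le_of_le (γ := γ) hr (L w)
    rw [he] at h1
    replace h1 := EReal.coe_le_coe_iff.1 h1
    have h2 : quadKernel (L w - z) - quadKernel (L x - z)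
        ≤ quadKernel (w - (x - L.adjoint (L x - z))) - quadKernel (x - (x - L.adjoint (L x - z))) := by
      have e1 : L w - z = L (w - x) + (L x - z) := by rw [map_sub]; abel
      have e2 : w - (x - L.adjoint (L x - z)) = (w - x) + L.adjoint (L x - z) := by abel
      rw [e1, e2, sub_sub_cancel, quadKernel_add, quadKernel_add,
        ContinuousLinearMap.adjoint_inner_right]
      linarith [quadKernel_map_le hL (w - x)]
    have h3 := mul_le_mul_of_nonneg_left h2 (one_div_pos.2 hγ).le
    linarith

lemma isProper_of_moreau_eq_coe {γ : ℝ} {p : H → EReal} {f : H → ℝ}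
    (h : moreau γ p = fun x => (f x : EReal)) : IsProper p := by
  constructor
  · have h0 : moreau γ p 0 < ((f 0 + 1 : ℝ) : EReal) := by
      rw [h]; exact EReal.coe_lt_coe_iff.2 (by linarith)
    obtain ⟨y, r, hr, -⟩ := moreau_lt_coe_iff.1 h0
    exact ⟨y, hr.trans_lt (EReal.coe_lt_top r)⟩
  · intro x hx
    have := moreau_le γ p x
    rw [hx, h] at this
    simp at this

/-! ### Minimizers of the Moreau envelope -/

lemma argmin_moreau {γ : ℝ} (hγ : 0 < γ) {φ : H → EReal} {f : H → ℝ}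
    (hf : moreau γ (conj φ) = fun x => (f x : EReal)) :
    argmin (moreau γ (conj φ)) = argmin (conj φ) := by
  ext x
  constructor
  · intro hx y
    refine le_trans ?_ ((hx y).trans (moreau_le γ _ y))
    have hmin : ∀ z, f x ≤ f z := fun z => by
      have := hx z
      rw [hf] at this
      exact EReal.coe_le_coe_iff.1 this
    rw [hf]
    refine conj_le_coe_iff.2 fun u c hc => ?_
    -- Lower semicontinuity by hand: a `t²`-optimal `z` in the envelope at `x` satisfies `Q(x - z) ≤
    -- γt²` by minimality of `x`, so each affine minorant of the conjugate changes by `O(t)` between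
    -- `z` and `x`.
    have key : ∀ t > 0, inner ℝ u x ≤ f x + c + t * (t + γ + quadKernel u) := by
      intro t ht
      have h0 : moreau γ (conj φ) x < ((f x + t ^ 2 : ℝ) : EReal) := by
        rw [hf]; exact EReal.coe_lt_coe_iff.2 (by nlinarith)
      obtain ⟨z, r, hr, hz⟩ := moreau_lt_coe_iff.1 h0
      have h1 : f z ≤ r := by
        have := (moreau_le γ (conj φ) z).trans hr
        rw [hf] at this
        exact EReal.coe_le_coe_iff.1 this
      have h2 := conj_le_coe_iff.1 hr u c hc
      have h3 : 1 / γ * quadKernel (x - z) ≤ t ^ 2 := by linarith [hmin z]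
      have h4 : quadKernel (x - z) ≤ γ * t ^ 2 := by
        have := mul_le_mul_of_nonneg_left h3 hγ.le
        rwa [← mul_assoc, mul_one_div_cancel hγ.ne', one_mul] at this
      have h5 : 1 / t * quadKernel (x - z) ≤ γ * t := by
        have := mul_le_mul_of_nonneg_left h4 (one_div_pos.2 ht).le
        have e : 1 / t * (γ * t ^ 2) = γ * t := by field_simp
        rwa [e] at this
      have h6 := inner_le_quadKernel ht (x - z) u
      have h7 : 0 ≤ 1 / γ * quadKernel (x - z) :=
        mul_nonneg (one_div_pos.2 hγ).le (quadKernel_nonneg _)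
      rw [inner_sub_left, real_inner_comm u x, real_inner_comm u z] at h6
      linarith
    have ht : Filter.Tendsto (fun t : ℝ => f x + c + t * (t + γ + quadKernel u))
        (nhdsWithin 0 (Set.Ioi 0)) (nhds (f x + c)) := by
      have : Continuous fun t : ℝ => f x + c + t * (t + γ + quadKernel u) := by fun_prop
      simpa using (this.tendsto 0).mono_left nhdsWithin_le_nhds
    exact ge_of_tendsto ht (eventually_mem_nhdsWithin.mono fun t h => key t h)
  · intro hx y
    refine (moreau_le γ _ x).trans (le_iInf fun z => (hx z).trans ?_)
    refine le_add_of_nonneg_right (EReal.coe_nonneg.2 ?_)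
    exact mul_nonneg (one_div_pos.2 hγ).le (quadKernel_nonneg _)

/-! ### Proximal cocompositions -/

lemma proxCocomp_eq (L : H →L[ℝ] G) (γ : ℝ) (g : G → EReal) :
    proxCocomp L γ g = invMoreau γ (moreau γ (conj (conj g)) ∘ L) := by
  unfold proxCocomp proxComp invMoreau
  simp only [one_div_one_div]

lemma isProper_conj_conj [CompleteSpace H] {g : H → EReal} (hg : IsProper g)
    (hcam : (cam g).Nonempty) : IsProper (conj (conj g)) := by
  obtain ⟨x, hx⟩ := hg.1
  refine ⟨⟨x, (conj_conj_le g x).trans_lt hx⟩, fun y => ?_⟩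
  obtain ⟨a, ha⟩ := hcam
  set v := (InnerProductSpace.toDual ℝ H).symm a.contLinear
  have hav : ∀ z, a z = inner ℝ v z + a 0 := fun z => by
    rw [InnerProductSpace.toDual_symm_apply]
    simpa using a.map_vadd 0 z
  -- The minorant `⟨v, ·⟩ + a 0` of `g` thereby also minorizes `g**`.
  have hle : conj g v ≤ ((-a 0 : ℝ) : EReal) := by
    rw [conj_le_coe_iff]
    intro z r hr
    have h1 := EReal.coe_le_coe_iff.1 ((ha z).trans hr)
    rw [hav, real_inner_comm] at h1
    linarith
  have : ((inner ℝ v y - -a 0 : ℝ) : EReal) ≤ conj (conj g) y := by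
    refine le_trans ?_ (le_iSup (fun u => ((inner ℝ u y : ℝ) : EReal) - conj g u) v)
    rw [EReal.coe_sub]
    exact EReal.sub_le_sub le_rfl hle
  exact ((EReal.bot_lt_coe _).trans_le this).ne'

lemma moreau_proxCocomp [CompleteSpace H] [CompleteSpace G] {L : H →L[ℝ] G} (hL : ‖L‖ ≤ 1)
    {g : G → EReal} (hg : IsProper (conj (conj g))) {γ : ℝ} (hγ : 0 < γ) :
    moreau γ (proxCocomp L γ g) = moreau γ (conj (conj g)) ∘ L := by
  obtain ⟨e, he⟩ := exists_coe_eq_moreau hγ hg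
  rw [proxCocomp_eq, he]
  exact moreau_invMoreau_comp hL hγ he

lemma moreau_proxCocomp_add [CompleteSpace H] [CompleteSpace G] {L : H →L[ℝ] G} (hL : ‖L‖ ≤ 1)
    {g : G → EReal} (hg : IsProper (conj (conj g))) {γ ρ : ℝ} (hγ : 0 < γ) (hρ : 0 < ρ) :
    moreau ρ (proxCocomp L (γ + ρ) g) = proxCocomp L γ (moreau ρ g) := by
  obtain ⟨e, he⟩ := exists_coe_eq_moreau (add_pos hγ hρ) hg
  have h := moreau_proxCocomp hL hg (add_pos hγ hρ)
  -- Properness makes the `ρ`-envelope of the cocomposition its own biconjugate, as cancelling the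
  -- outer `γ`-envelope requires.
  have hp : IsProper (proxCocomp L (γ + ρ) g) :=
    isProper_of_moreau_eq_coe (f := e ∘ L) (h.trans (by rw [he]; rfl))
  rw [proxCocomp_eq L γ, conj_conj_moreau_eq hρ hg, moreau_moreau hγ hρ, ← h,
    ← moreau_moreau hγ hρ]
  exact (invMoreau_moreau hγ (conj_conj_moreau hρ hp)).symm

lemma argmin_proxCocomp [CompleteSpace H] [CompleteSpace G] {L : H →L[ℝ] G} (hL : ‖L‖ ≤ 1)
    {g : G → EReal} (hg : IsProper (conj (conj g))) {γ : ℝ} (hγ : 0 < γ) :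
    argmin (proxCocomp L γ g) = argmin (moreau γ (conj (conj g)) ∘ L) := by
  obtain ⟨e, he⟩ := exists_coe_eq_moreau hγ hg
  have h := moreau_proxCocomp hL hg hγ
  rw [← h]
  exact (argmin_moreau (f := e ∘ L) hγ (h.trans (by rw [he]; rfl))).symm

end ProxComp

theorem mainTheorem8
    {H : Type*} [NormedAddCommGroup H] [InnerProductSpace ℝ H] [CompleteSpace H]
    {G : Type*} [NormedAddCommGroup G] [InnerProductSpace ℝ G] [CompleteSpace G]
    (L : H →L[ℝ] G) (hL0 : 0 < ‖L‖) (hL1 : ‖L‖ ≤ 1)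
    (g : G → EReal) (hg : ProxComp.IsProper g) (hcam : (ProxComp.cam g).Nonempty) :
    (∀ γ ρ : ℝ, 0 < γ → 0 < ρ →
      ProxComp.moreau ρ (ProxComp.proxCocomp L (γ + ρ) g)
        = ProxComp.proxCocomp L γ (ProxComp.moreau ρ g)) ∧
    (∀ γ : ℝ, 0 < γ →
      ProxComp.moreau γ (ProxComp.proxCocomp L γ g)
        = ProxComp.moreau γ (ProxComp.conj (ProxComp.conj g)) ∘ L) ∧
    (∀ γ : ℝ, 0 < γ →
      ProxComp.argmin (ProxComp.proxCocomp L γ g)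
        = ProxComp.argmin (ProxComp.moreau γ (ProxComp.conj (ProxComp.conj g)) ∘ L)) := by
  have hp := ProxComp.isProper_conj_conj hg hcam
  exact ⟨fun γ ρ hγ hρ => ProxComp.moreau_proxCocomp_add hL1 hp hγ hρ,
    fun γ hγ => ProxComp.moreau_proxCocomp hL1 hp hγ,
    fun γ hγ => ProxComp.argmin_proxCocomp hL1 hp hγ⟩
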